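/- Let $p,q\ge 0$ be integers, $n=p+q$, and let $I_{p,q}=\operatorname{diag}(1,\dots,1,-1,\dots,-1)\in M_n(\mathbb{C})$, with $p$ entries $1$ followed by $q$ entries $-1$. Let $$U(p,q)=\{A\in GL(n,\mathbb{C}) : A^{*}I_{p,q}A=I_{p,q}\}$$ be the indefinite unitary group and let $$\mathfrak{u}_{p,q}=\{X\in M_n(\mathbb{C}) : X^{*}I_{p,q}+I_{p,q}X=0\}$$ be its (real) Lie algebra. Then the matrix exponential $X\mapsto e^{X}=\sum_{k\ge 0}X^{k}/k!$, which maps $\mathfrak{u}_{p,q}$ into $U(p,q)$, is a surjective map $\exp:\mathfrak{u}_{p,q}\to U(p,q)$. -/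

import Mathlib

open scoped Matrix

attribute [local instance 100] LieRing.ofAssociativeRing

/-- The matrix `I_{p,q} = diag(1, …, 1, -1, …, -1)` (`p` entries `1`, then `q` entries `-1`), with
rows and columns indexed by the disjoint union of `Fin p` and `Fin q`. -/
def signatureMatrix (p q : ℕ) : Matrix (Fin p ⊕ Fin q) (Fin p ⊕ Fin q) ℂ :=
  LieAlgebra.Orthogonal.indefiniteDiagonal (Fin p) (Fin q) ℂ

theorem signatureMatrix_mul_self (p q : ℕ) : signatureMatrix p q * signatureMatrix p q = 1 := by
  rw [signatureMatrix, LieAlgebra.Orthogonal.indefiniteDiagonal, Matrix.diagonal_mul_diagonal,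
    ← Matrix.diagonal_one]
  congr 1
  funext i
  rcases i with i | i <;> simp

/-- The indefinite unitary group `U(p,q)`: the subgroup of those `A ∈ GL(p+q, ℂ)` with
`A⋆ I_{p,q} A = I_{p,q}`. -/
def indefiniteUnitaryGroup (p q : ℕ) : Subgroup (GL (Fin p ⊕ Fin q) ℂ) where
  carrier := {A | (A : Matrix (Fin p ⊕ Fin q) (Fin p ⊕ Fin q) ℂ)ᴴ * signatureMatrix p q *
    (A : Matrix (Fin p ⊕ Fin q) (Fin p ⊕ Fin q) ℂ) = signatureMatrix p q}
  one_mem' := by simp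
  mul_mem' := by
    intro A B hA hB
    simp only [Set.mem_ofPred_eq] at hA hB ⊢
    rw [Units.val_mul, Matrix.conjTranspose_mul]
    calc _ = (B : Matrix (Fin p ⊕ Fin q) (Fin p ⊕ Fin q) ℂ)ᴴ *
          ((A : Matrix (Fin p ⊕ Fin q) (Fin p ⊕ Fin q) ℂ)ᴴ * signatureMatrix p q *
            (A : Matrix (Fin p ⊕ Fin q) (Fin p ⊕ Fin q) ℂ)) *
          (B : Matrix (Fin p ⊕ Fin q) (Fin p ⊕ Fin q) ℂ) := by simp only [mul_assoc]
      _ = signatureMatrix p q := by rw [hA, hB]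
  inv_mem' := by
    intro A hA
    simp only [Set.mem_ofPred_eq] at hA ⊢
    have h1 : (A : Matrix (Fin p ⊕ Fin q) (Fin p ⊕ Fin q) ℂ) *
        ((A⁻¹ : GL (Fin p ⊕ Fin q) ℂ) : Matrix (Fin p ⊕ Fin q) (Fin p ⊕ Fin q) ℂ) = 1 :=
      A.mul_inv
    have h2 : ((A⁻¹ : GL (Fin p ⊕ Fin q) ℂ) : Matrix (Fin p ⊕ Fin q) (Fin p ⊕ Fin q) ℂ)ᴴ *
        (A : Matrix (Fin p ⊕ Fin q) (Fin p ⊕ Fin q) ℂ)ᴴ = 1 := by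
      rw [← Matrix.conjTranspose_mul, h1, Matrix.conjTranspose_one]
    conv_lhs => rw [← hA]
    rw [mul_assoc, mul_assoc, h1, mul_one, ← mul_assoc, h2, one_mul]

/-- The real Lie algebra `𝔲_{p,q}`: the complex matrices `X` with `X⋆ I_{p,q} + I_{p,q} X = 0`,
with the commutator bracket. -/
def indefiniteUnitaryLieAlgebra (p q : ℕ) :
    LieSubalgebra ℝ (Matrix (Fin p ⊕ Fin q) (Fin p ⊕ Fin q) ℂ) where
  carrier := {X | Xᴴ * signatureMatrix p q + signatureMatrix p q * X = 0}
  zero_mem' := by simp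
  add_mem' := by
    intro X Y hX hY
    simp only [Set.mem_ofPred_eq] at hX hY ⊢
    rw [Matrix.conjTranspose_add, add_mul, mul_add, add_add_add_comm, hX, hY, add_zero]
  smul_mem' := by
    intro c X hX
    simp only [Set.mem_ofPred_eq] at hX ⊢
    rw [Matrix.conjTranspose_smul, star_trivial, smul_mul_assoc, mul_smul_comm, ← smul_add, hX,
      smul_zero]
  lie_mem' := by
    intro X Y hX hY
    have hX' : Xᴴ * signatureMatrix p q = -(signatureMatrix p q * X) := eq_neg_of_add_eq_zero_left hX
    have hY' : Yᴴ * signatureMatrix p q = -(signatureMatrix p q * Y) := eq_neg_of_add_eq_zero_left hY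
    change (⁅X, Y⁆)ᴴ * signatureMatrix p q + signatureMatrix p q * ⁅X, Y⁆ = 0
    rw [Ring.lie_def, Matrix.conjTranspose_sub, Matrix.conjTranspose_mul, Matrix.conjTranspose_mul,
      sub_mul, mul_assoc, mul_assoc, hX', hY', mul_neg, mul_neg, ← mul_assoc, ← mul_assoc, hX', hY']
    noncomm_ring

/-- The matrix exponential of an element of `𝔲_{p,q}` lies in `U(p,q)`. -/
theorem exp_mem_indefiniteUnitaryGroup (p q : ℕ) (X : indefiniteUnitaryLieAlgebra p q) :
    (Matrix.isUnit_exp (X : Matrix (Fin p ⊕ Fin q) (Fin p ⊕ Fin q) ℂ)).unit ∈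
      indefiniteUnitaryGroup p q := by
  obtain ⟨X, hX⟩ := X
  change (NormedSpace.exp X)ᴴ * signatureMatrix p q * NormedSpace.exp X = signatureMatrix p q
  have hX' : Xᴴ * signatureMatrix p q = signatureMatrix p q * (-X) := by
    rw [mul_neg]; exact eq_neg_of_add_eq_zero_left hX
  let J : (Matrix (Fin p ⊕ Fin q) (Fin p ⊕ Fin q) ℂ)ˣ :=
    ⟨signatureMatrix p q, signatureMatrix p q, signatureMatrix_mul_self p q,
      signatureMatrix_mul_self p q⟩
  have h1 : Xᴴ = (J : Matrix (Fin p ⊕ Fin q) (Fin p ⊕ Fin q) ℂ) * (-X) *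
      ((J⁻¹ : (Matrix (Fin p ⊕ Fin q) (Fin p ⊕ Fin q) ℂ)ˣ) :
        Matrix (Fin p ⊕ Fin q) (Fin p ⊕ Fin q) ℂ) := by
    change Xᴴ = signatureMatrix p q * (-X) * signatureMatrix p q
    rw [← hX', mul_assoc, signatureMatrix_mul_self, mul_one]
  have h2 : NormedSpace.exp (-X) * NormedSpace.exp X = 1 := by
    rw [← Matrix.exp_add_of_commute (-X) X (Commute.neg_left (Commute.refl X)), neg_add_cancel,
      NormedSpace.exp_zero]
  rw [← Matrix.exp_conjTranspose, h1, Matrix.exp_units_conj]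
  change signatureMatrix p q * NormedSpace.exp (-X) * signatureMatrix p q * signatureMatrix p q *
    NormedSpace.exp X = signatureMatrix p q
  rw [mul_assoc (signatureMatrix p q * NormedSpace.exp (-X)), signatureMatrix_mul_self, mul_one,
    mul_assoc, h2, mul_one]

/-- The exponential map `exp : 𝔲_{p,q} → U(p,q)`, `X ↦ ∑ₖ Xᵏ / k!`. -/
noncomputable def indefiniteUnitaryExp (p q : ℕ) (X : indefiniteUnitaryLieAlgebra p q) :
    indefiniteUnitaryGroup p q :=
  ⟨(Matrix.isUnit_exp (X : Matrix (Fin p ⊕ Fin q) (Fin p ⊕ Fin q) ℂ)).unit,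
    exp_mem_indefiniteUnitaryGroup p q X⟩

theorem coe_indefiniteUnitaryExp (p q : ℕ) (X : indefiniteUnitaryLieAlgebra p q) :
    ((indefiniteUnitaryExp p q X : GL (Fin p ⊕ Fin q) ℂ) :
      Matrix (Fin p ⊕ Fin q) (Fin p ⊕ Fin q) ℂ) =
      NormedSpace.exp (X : Matrix (Fin p ⊕ Fin q) (Fin p ⊕ Fin q) ℂ) := rfl

/-!
For `b` joined to `1` by a segment of units, `L b = ∫₀¹ (b - 1) (1 + t (b - 1))⁻¹ dt` is a logarithm
of `b`. The formula is natural: it commutes with `star`, it transports any relation `j b = c j` to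
`j (L b) = (L c) j`, and the substitution `t ↦ 1 - t` gives `L b⁻¹ = -L b`. Hence `b⋆ j b = j`,
read as `j b⁻¹ = b⋆ j`, becomes `-j (L b) = (L b)⋆ j`. A matrix has finitely many eigenvalues, so
multiplication by some phase moves them all off the negative real axis; the phase has a purely
imaginary logarithm, which satisfies the same linear relation.
-/

open AffineMap MeasureTheory NormedSpace Set

open scoped Ring

theorem semiconjBy_ringInverse {M₀ : Type*} [MonoidWithZero M₀] {a x y : M₀} (hx : IsUnit x)
    (hy : IsUnit y) (h : SemiconjBy a x y) : SemiconjBy a x⁻¹ʳ y⁻¹ʳ := by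
  lift x to M₀ˣ using hx
  lift y to M₀ˣ using hy
  simpa only [Ring.inverse_unit] using h.units_inv_right

section PrincipalLog

variable {𝔸 : Type*} [NormedRing 𝔸] [NormedAlgebra ℝ 𝔸]

variable (𝔸) in
/-- The domain of the principal logarithm: the elements that a line segment of units joins to `1`.
In a complex Banach algebra it consists of the elements with spectrum in `Complex.slitPlane`. -/
def principalLogDomain : Set 𝔸 :=
  {b | ∀ t ∈ Icc (0 : ℝ) 1, IsUnit (lineMap 1 b t)}

/-- The logarithmic derivative at time `t` of the segment from `1` to `b`. -/
noncomputable def segmentLogDeriv (b : 𝔸) (t : ℝ) : 𝔸 :=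
  (b - 1) * (lineMap 1 b t)⁻¹ʳ

/-- The principal logarithm, as the integral of the logarithmic derivative of the segment from `1`
to `b`; it is meaningful for `b` in `principalLogDomain`. -/
noncomputable def principalLog (b : 𝔸) : 𝔸 :=
  ∫ t in (0 : ℝ)..1, segmentLogDeriv b t

theorem isUnit_of_mem_principalLogDomain {b : 𝔸} (hb : b ∈ principalLogDomain 𝔸) : IsUnit b := by
  simpa only [lineMap_apply_one] using hb 1 (right_mem_Icc.2 zero_le_one)

theorem semiconjBy_lineMap_one {j b c : 𝔸} (h : SemiconjBy j b c) (t : ℝ) :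
    SemiconjBy j (lineMap 1 b t) (lineMap 1 c t) := by
  simp only [lineMap_apply_module, SemiconjBy, mul_add, add_mul, mul_smul_comm, smul_mul_assoc,
    mul_one, one_mul, h.eq]

theorem semiconjBy_segmentLogDeriv {j b c : 𝔸} {t : ℝ} (hb : IsUnit (lineMap 1 b t))
    (hc : IsUnit (lineMap 1 c t)) (h : SemiconjBy j b c) :
    SemiconjBy j (segmentLogDeriv b t) (segmentLogDeriv c t) :=
  (h.sub_right (SemiconjBy.one_right j)).mul_right
    (semiconjBy_ringInverse hb hc (semiconjBy_lineMap_one h t))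

theorem lineMap_one_inv (b : 𝔸ˣ) (t : ℝ) :
    lineMap (1 : 𝔸) ↑b⁻¹ t = lineMap 1 (b : 𝔸) (1 - t) * ↑b⁻¹ := by
  simp only [lineMap_apply_module, sub_sub_cancel, add_mul, smul_mul_assoc, one_mul,
    Units.mul_inv, add_comm]

theorem inv_mem_principalLogDomain {b : 𝔸ˣ} (hb : (b : 𝔸) ∈ principalLogDomain 𝔸) :
    (↑b⁻¹ : 𝔸) ∈ principalLogDomain 𝔸 := fun t ht ↦ by
  rw [lineMap_one_inv]
  exact (hb _ (Icc.one_sub_mem ht)).mul b⁻¹.isUnit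

theorem segmentLogDeriv_inv (b : 𝔸ˣ) (t : ℝ) :
    segmentLogDeriv (↑b⁻¹ : 𝔸) t = -segmentLogDeriv (b : 𝔸) (1 - t) := by
  rw [segmentLogDeriv, segmentLogDeriv, lineMap_one_inv, Ring.inverse_mul (.inr b⁻¹.isUnit),
    Ring.inverse_unit, inv_inv, ← mul_assoc, sub_mul, Units.inv_mul, one_mul, ← neg_mul, neg_sub]

theorem principalLog_inv (b : 𝔸ˣ) : principalLog (↑b⁻¹ : 𝔸) = -principalLog (b : 𝔸) := by
  simp only [principalLog, segmentLogDeriv_inv, intervalIntegral.integral_neg,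
    intervalIntegral.integral_comp_sub_left (segmentLogDeriv (b : 𝔸)), sub_self, sub_zero]

section Star

variable [StarRing 𝔸] [StarModule ℝ 𝔸]

theorem star_lineMap_one (b : 𝔸) (t : ℝ) : star (lineMap 1 b t) = lineMap 1 (star b) t := by
  simp only [lineMap_apply_module, star_add, star_smul, star_one, star_trivial]

theorem star_mem_principalLogDomain {b : 𝔸} (hb : b ∈ principalLogDomain 𝔸) :
    star b ∈ principalLogDomain 𝔸 := fun t ht ↦ by
  simpa only [star_lineMap_one] using (hb t ht).star

theorem star_segmentLogDeriv {b : 𝔸} {t : ℝ} (hb : IsUnit (lineMap 1 b t)) :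
    star (segmentLogDeriv b t) = segmentLogDeriv (star b) t := by
  have hcomm : Commute (b - 1) (lineMap 1 b t)⁻¹ʳ :=
    semiconjBy_ringInverse hb hb
      (semiconjBy_lineMap_one ((Commute.refl b).sub_left (Commute.one_left b)) t)
  rw [segmentLogDeriv, segmentLogDeriv, hcomm.eq, star_mul, star_sub, star_one,
    ← Ring.inverse_star, star_lineMap_one]

end Star

variable [CompleteSpace 𝔸]

theorem continuousAt_segmentLogDeriv {b : 𝔸} {t : ℝ} (hb : IsUnit (lineMap 1 b t)) :
    ContinuousAt (segmentLogDeriv b) t := by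
  have hinv : ContinuousAt Ring.inverse (lineMap 1 b t : 𝔸) :=
    NormedRing.inverse_continuousAt hb.unit
  exact continuousAt_const.mul (hinv.comp (f := lineMap 1 b) lineMap_continuous.continuousAt)

theorem intervalIntegrable_segmentLogDeriv {b : 𝔸} (hb : b ∈ principalLogDomain 𝔸) {t : ℝ}
    (ht : t ∈ Icc (0 : ℝ) 1) : IntervalIntegrable (segmentLogDeriv b) volume 0 t :=
  ContinuousOn.intervalIntegrable_of_Icc ht.1 fun s hs ↦
    (continuousAt_segmentLogDeriv (hb s ⟨hs.1, hs.2.trans ht.2⟩)).continuousWithinAt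

theorem hasDerivAt_integral_segmentLogDeriv {b : 𝔸} (hb : b ∈ principalLogDomain 𝔸) {t : ℝ}
    (ht : t ∈ Icc (0 : ℝ) 1) :
    HasDerivAt (fun s ↦ ∫ r in (0 : ℝ)..s, segmentLogDeriv b r) (segmentLogDeriv b t) t := by
  have hopen : IsOpen {s : ℝ | IsUnit (lineMap 1 b s)} :=
    Units.isOpen.preimage lineMap_continuous
  exact intervalIntegral.integral_hasDerivAt_right (intervalIntegrable_segmentLogDeriv hb ht)
    (ContinuousAt.stronglyMeasurableAtFilter hopen (fun _ ↦ continuousAt_segmentLogDeriv) t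
      (hb t ht))
    (continuousAt_segmentLogDeriv (hb t ht))

theorem semiconjBy_intervalIntegral {μ : Measure ℝ} {f g : ℝ → 𝔸} {x y : ℝ} {j : 𝔸}
    (hf : IntervalIntegrable f μ x y) (hg : IntervalIntegrable g μ x y)
    (h : ∀ t ∈ uIcc x y, SemiconjBy j (f t) (g t)) :
    SemiconjBy j (∫ t in x..y, f t ∂μ) (∫ t in x..y, g t ∂μ) :=
  calc j * ∫ t in x..y, f t ∂μ
      = ∫ t in x..y, j * f t ∂μ :=
        ((ContinuousLinearMap.mul ℝ 𝔸 j).intervalIntegral_comp_comm hf).symm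
    _ = ∫ t in x..y, g t * j ∂μ := intervalIntegral.integral_congr fun t ht ↦ (h t ht).eq
    _ = (∫ t in x..y, g t ∂μ) * j :=
        ((ContinuousLinearMap.mul ℝ 𝔸).flip j).intervalIntegral_comp_comm hg

theorem semiconjBy_integral_segmentLogDeriv {j b c : 𝔸} (hb : b ∈ principalLogDomain 𝔸)
    (hc : c ∈ principalLogDomain 𝔸) (h : SemiconjBy j b c) {t : ℝ} (ht : t ∈ Icc (0 : ℝ) 1) :
    SemiconjBy j (∫ s in (0 : ℝ)..t, segmentLogDeriv b s)
      (∫ s in (0 : ℝ)..t, segmentLogDeriv c s) := by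
  refine semiconjBy_intervalIntegral (intervalIntegrable_segmentLogDeriv hb ht)
    (intervalIntegrable_segmentLogDeriv hc ht) fun s hs ↦ ?_
  rw [uIcc_of_le ht.1] at hs
  have hs' : s ∈ Icc (0 : ℝ) 1 := ⟨hs.1, hs.2.trans ht.2⟩
  exact semiconjBy_segmentLogDeriv (hb s hs') (hc s hs') h

theorem semiconjBy_principalLog {j b c : 𝔸} (hb : b ∈ principalLogDomain 𝔸)
    (hc : c ∈ principalLogDomain 𝔸) (h : SemiconjBy j b c) :
    SemiconjBy j (principalLog b) (principalLog c) :=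
  semiconjBy_integral_segmentLogDeriv hb hc h (right_mem_Icc.2 zero_le_one)

theorem commute_integral_segmentLogDeriv {b : 𝔸} (hb : b ∈ principalLogDomain 𝔸) {s t : ℝ}
    (hs : s ∈ Icc (0 : ℝ) 1) (ht : t ∈ Icc (0 : ℝ) 1) :
    Commute (∫ r in (0 : ℝ)..s, segmentLogDeriv b r) (∫ r in (0 : ℝ)..t, segmentLogDeriv b r) :=
  have hbs : Commute b (∫ r in (0 : ℝ)..s, segmentLogDeriv b r) :=
    semiconjBy_integral_segmentLogDeriv hb hb (Commute.refl b) hs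
  semiconjBy_integral_segmentLogDeriv hb hb hbs.symm ht

theorem hasDerivWithinAt_exp_comp_of_commute {f : ℝ → 𝔸} {f' : 𝔸} {s : Set ℝ} {t : ℝ} (ht : t ∈ s)
    (hf : HasDerivWithinAt f f' s t) (hcomm : ∀ r ∈ s, Commute (f t) (f r)) :
    HasDerivWithinAt (fun r ↦ exp (f r)) (exp (f t) * f') s t := by
  let +nondep : NormedAlgebra ℚ 𝔸 := .restrictScalars ℚ ℝ 𝔸
  have hincr : HasDerivWithinAt (fun r ↦ exp (f r - f t)) f' s t := by
    have hexp : HasFDerivAt exp (1 : 𝔸 →L[ℝ] 𝔸) (f t - f t) := by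
      rw [sub_self]; exact hasFDerivAt_exp_zero
    exact hexp.comp_hasDerivWithinAt t (hf.sub_const (f t))
  have hfactor : ∀ r ∈ s, exp (f r) = exp (f t) * exp (f r - f t) := fun r hr ↦ by
    rw [← exp_add_of_commute ((hcomm r hr).sub_right (Commute.refl _)), add_sub_cancel]
  exact (hincr.const_mul (exp (f t))).congr hfactor (hfactor t ht)

theorem hasDerivWithinAt_exp_neg_integral_mul_lineMap {b : 𝔸} (hb : b ∈ principalLogDomain 𝔸)
    {t : ℝ} (ht : t ∈ Icc (0 : ℝ) 1) :
    HasDerivWithinAt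
      (fun s ↦ exp (-∫ r in (0 : ℝ)..s, segmentLogDeriv b r) * lineMap (1 : 𝔸) b s) 0
      (Icc 0 1) t := by
  have hexp := hasDerivWithinAt_exp_comp_of_commute ht
    (hasDerivAt_integral_segmentLogDeriv hb ht).neg.hasDerivWithinAt
    fun s hs ↦ (commute_integral_segmentLogDeriv hb ht hs).neg_left.neg_right
  have hline : HasDerivWithinAt (lineMap 1 b) (b - 1) (Icc (0 : ℝ) 1) t :=
    hasDerivAt_lineMap.hasDerivWithinAt
  refine (hexp.mul hline).congr_deriv ?_
  have hlog : segmentLogDeriv b t * lineMap 1 b t = b - 1 := by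
    rw [segmentLogDeriv, mul_assoc, Ring.inverse_mul_cancel _ (hb t ht), mul_one]
  simp only [mul_neg, neg_mul, mul_assoc, hlog, neg_add_cancel]

theorem exp_principalLog {b : 𝔸} (hb : b ∈ principalLogDomain 𝔸) : exp (principalLog b) = b := by
  let +nondep : NormedAlgebra ℚ 𝔸 := .restrictScalars ℚ ℝ 𝔸
  have hderiv := fun t ht ↦ hasDerivWithinAt_exp_neg_integral_mul_lineMap hb (t := t) ht
  have hconst := constant_of_derivWithin_zero
    (fun t ht ↦ (hderiv t ht).differentiableWithinAt)
    (fun t ht ↦ (hderiv t (Ico_subset_Icc_self ht)).derivWithin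
      (uniqueDiffOn_Icc zero_lt_one t (Ico_subset_Icc_self ht)))
    1 (right_mem_Icc.2 zero_le_one)
  have hone : exp (-principalLog b) * b = 1 := by
    simpa [principalLog] using hconst
  calc exp (principalLog b)
      = exp (principalLog b) * (exp (-principalLog b) * b) := by rw [hone, mul_one]
    _ = b := by
      rw [← mul_assoc, ← exp_add_of_commute (Commute.refl _).neg_right, add_neg_cancel, exp_zero,
        one_mul]

section Star

variable [StarRing 𝔸] [StarModule ℝ 𝔸] [ContinuousStar 𝔸]

theorem star_principalLog {b : 𝔸} (hb : b ∈ principalLogDomain 𝔸) :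
    star (principalLog b) = principalLog (star b) := by
  have hint := intervalIntegrable_segmentLogDeriv hb (right_mem_Icc.2 zero_le_one)
  calc star (principalLog b)
      = ∫ t in (0 : ℝ)..1, star (segmentLogDeriv b t) :=
        ((starL' ℝ : 𝔸 ≃L[ℝ] 𝔸).toContinuousLinearMap.intervalIntegral_comp_comm hint).symm
    _ = principalLog (star b) := intervalIntegral.integral_congr fun t ht ↦
        star_segmentLogDeriv (hb t (by rwa [uIcc_of_le zero_le_one] at ht))

theorem star_principalLog_mul_add_mul_principalLog {j b : 𝔸} (hb : b ∈ principalLogDomain 𝔸)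
    (h : star b * j * b = j) : star (principalLog b) * j + j * principalLog b = 0 := by
  lift b to 𝔸ˣ using isUnit_of_mem_principalLogDomain hb
  have hinv : SemiconjBy j (↑b⁻¹ : 𝔸) (star b) := by
    rw [SemiconjBy, Units.mul_inv_eq_iff_eq_mul, h]
  have hlog := semiconjBy_principalLog (inv_mem_principalLogDomain hb)
    (star_mem_principalLogDomain hb) hinv
  rw [principalLog_inv, ← star_principalLog hb, SemiconjBy, mul_neg] at hlog
  rw [← hlog, neg_add_cancel]

end Star

end PrincipalLog

open scoped ComplexOrder in
theorem exists_exp_neg_mul_I_mul_mem_slitPlane {S : Set ℂ} (hS : S.Finite) (h0 : 0 ∉ S) :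
    ∃ θ : ℝ, ∀ z ∈ S, Complex.exp (-(θ * Complex.I)) * z ∈ Complex.slitPlane := by
  obtain ⟨θ, hθ, hθS⟩ := (Ioc_infinite (neg_lt_self Real.pi_pos)).exists_notMem_finite
    (hS.image fun z ↦ Complex.arg (-z))
  refine ⟨θ, fun z hz ↦ Complex.mem_slitPlane_iff_not_le_zero.2 fun hle ↦ hθS ⟨z, hz, ?_⟩⟩
  have hz0 : z ≠ 0 := ne_of_mem_of_not_mem hz h0
  obtain ⟨r, hr, hrz⟩ : ∃ r : ℝ, r > 0 ∧ (r : ℂ) = Complex.exp (-(θ * Complex.I)) * -z := by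
    refine RCLike.pos_iff_exists_ofReal.1 ?_
    rw [mul_neg, Left.neg_pos_iff]
    exact hle.lt_of_ne (mul_ne_zero (Complex.exp_ne_zero _) hz0)
  have hneg : -z = r * (Complex.cos θ + Complex.sin θ * Complex.I) := by
    rw [hrz, ← Complex.exp_mul_I, mul_right_comm, ← Complex.exp_add, neg_add_cancel,
      Complex.exp_zero, one_mul]
  simpa only [hneg] using Complex.arg_mul_cos_add_sin_mul_I hr hθ

section ComplexBanachAlgebra

variable {𝔸 : Type*} [NormedRing 𝔸] [NormedAlgebra ℂ 𝔸]

theorem mem_principalLogDomain_of_spectrum_subset_slitPlane {b : 𝔸}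
    (hb : spectrum ℂ b ⊆ Complex.slitPlane) : b ∈ principalLogDomain 𝔸 := by
  rintro t ⟨ht0, ht1⟩
  rcases ht0.eq_or_lt with rfl | ht0
  · simp
  have hratio : (((t - 1) / t : ℝ) : ℂ) ∉ spectrum ℂ b := fun hmem ↦
    absurd (Complex.ofReal_mem_slitPlane.1 (hb hmem))
      (div_nonpos_of_nonpos_of_nonneg (sub_nonpos.2 ht1) ht0.le).not_gt
  have hline : lineMap 1 b t = (-t : ℂ) • (algebraMap ℂ 𝔸 ((t - 1) / t : ℝ) - b) := by
    rw [Algebra.algebraMap_eq_smul_one, smul_sub, smul_smul, ← Complex.ofReal_neg,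
      ← Complex.ofReal_mul, lineMap_apply_module, Complex.coe_smul, Complex.coe_smul, neg_smul,
      sub_neg_eq_add, neg_mul, mul_div_cancel₀ _ ht0.ne', neg_sub]
  have hunit : IsUnit (-t : ℂ) := (neg_ne_zero.2 (Complex.ofReal_ne_zero.2 ht0.ne')).isUnit
  rw [hline, Algebra.smul_def]
  exact (hunit.map (algebraMap ℂ 𝔸)).mul (spectrum.notMem_iff.1 hratio)

theorem exp_smul_mem_principalLogDomain {a : 𝔸} {c : ℂ}
    (h : ∀ z ∈ spectrum ℂ a, Complex.exp c * z ∈ Complex.slitPlane) :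
    Complex.exp c • a ∈ principalLogDomain 𝔸 := by
  refine mem_principalLogDomain_of_spectrum_subset_slitPlane ?_
  have hspec := spectrum.unit_smul_eq_smul a (Units.mk0 _ (Complex.exp_ne_zero c))
  rw [Units.smul_mk0] at hspec
  rw [hspec]
  rintro _ ⟨z, hz, rfl⟩
  exact h z hz

variable [CompleteSpace 𝔸]

theorem exp_principalLog_exp_smul_sub {a : 𝔸} {c : ℂ}
    (h : Complex.exp c • a ∈ principalLogDomain 𝔸) :
    exp (principalLog (Complex.exp c • a) - algebraMap ℂ 𝔸 c) = a := by
  let +nondep : NormedAlgebra ℚ 𝔸 := .restrictScalars ℚ ℝ 𝔸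
  rw [sub_eq_add_neg, ← map_neg, exp_add_of_commute (Algebra.commutes _ _).symm,
    exp_principalLog h, ← algebraMap_exp_comm, ← Complex.exp_eq_exp_ℂ, ← Algebra.commutes,
    ← Algebra.smul_def, smul_smul, ← Complex.exp_add, neg_add_cancel, Complex.exp_zero, one_smul]

variable [StarRing 𝔸] [StarModule ℂ 𝔸] [ContinuousStar 𝔸]

theorem star_principalLog_exp_smul_sub_mul_add {j a : 𝔸} {c : ℂ} (hc : star c = -c)
    (hdom : Complex.exp c • a ∈ principalLogDomain 𝔸) (h : star a * j * a = j) :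
    star (principalLog (Complex.exp c • a) - algebraMap ℂ 𝔸 c) * j +
      j * (principalLog (Complex.exp c • a) - algebraMap ℂ 𝔸 c) = 0 := by
  have hunimodular : star (Complex.exp c) * Complex.exp c = 1 := by
    rw [Complex.star_def, ← Complex.exp_conj, ← Complex.star_def, hc, ← Complex.exp_add,
      neg_add_cancel, Complex.exp_zero]
  have hisom : star (Complex.exp c • a) * j * (Complex.exp c • a) = j := by
    rw [star_smul, smul_mul_assoc, smul_mul_assoc, mul_smul_comm, smul_smul, hunimodular, one_smul,
      h]
  rw [star_sub, ← algebraMap_star_comm, hc, map_neg, sub_neg_eq_add, add_mul, mul_sub,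
    Algebra.commutes c j, add_add_sub_cancel, star_principalLog_mul_add_mul_principalLog hdom hisom]

theorem exists_exp_eq_of_star_mul_mul_eq {j a : 𝔸} (ha : IsUnit a)
    (hfin : (spectrum ℂ a).Finite) (h : star a * j * a = j) :
    ∃ x : 𝔸, star x * j + j * x = 0 ∧ exp x = a := by
  obtain ⟨θ, hθ⟩ := exists_exp_neg_mul_I_mul_mem_slitPlane hfin (spectrum.zero_notMem ℂ ha)
  have hskew : star (-(θ * Complex.I)) = -(-(θ * Complex.I)) := by simp
  have hdom := exp_smul_mem_principalLogDomain hθ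
  exact ⟨_, star_principalLog_exp_smul_sub_mul_add hskew hdom h, exp_principalLog_exp_smul_sub hdom⟩

end ComplexBanachAlgebra

open scoped Matrix.Norms.L2Operator in
theorem mainTheorem8_general {n : Type*} [Fintype n] [DecidableEq n] (J : Matrix n n ℂ)
    (A : GL n ℂ) (hA : (A : Matrix n n ℂ)ᴴ * J * A = J) :
    ∃ X : Matrix n n ℂ, Xᴴ * J + J * X = 0 ∧ exp X = A :=
  exists_exp_eq_of_star_mul_mul_eq A.isUnit (Matrix.finite_spectrum _) hA

theorem mainTheorem8 (p q : ℕ) : Function.Surjective (indefiniteUnitaryExp p q) := by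
  rintro ⟨A, hA⟩
  obtain ⟨X, hX, hexp⟩ := mainTheorem8_general (signatureMatrix p q) A hA
  exact ⟨⟨X, hX⟩, Subtype.ext (Units.ext hexp)⟩
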